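/- Let $x_1,\dots,x_n\in[-1,1]^k$ be the rows of a design, let $\bar x_1,\dots,\bar x_q$ be the distinct values among them, listed without repetition, and suppose $q<n$. Let $Z$ be the $n\times q$ matrix with $Z_{ij}=1$ if $x_i=\bar x_j$ and $Z_{ij}=0$ otherwise, and put $H_Z=Z(Z^{\mathsf T}Z)^{-1}Z^{\mathsf T}$. Let $f:[-1,1]^k\to\mathbb R^p$ be a regression function, let $F$ be the $n\times p$ matrix with $i$th row $f(x_i)^{\mathsf T}$, and suppose that $F^{\mathsf T}F$ is invertible. Let $\mu:[-1,1]^k\to\mathbb R$ be any function, $\boldsymbol\mu=(\mu(x_1),\dots,\mu(x_n))^{\mathsf T}$, $\bar{\boldsymbol\mu}=(\mu(\bar x_1),\dots,\mu(\bar x_q))^{\mathsf T}$, and let $\kappa>0$. Let $y\sim N(Z\bar{\boldsymbol\mu},\kappa I_n)$, let $$\tilde\sigma^2=\frac{1}{n-q}\,y^{\mathsf T}(I_n-H_Z)y,\qquad w=\frac1{2\tilde\sigma^2},$$ and for $t\in\mathbb R^p$ consider the expected weighted sum-of-squares loss $$L(t)=\mathrm E\Big[w\sum_{i=1}^n\big(y_i-f(x_i)^{\mathsf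 T}t\big)^2\Big]\in[0,\infty].$$ The target parameter values are the minimisers of $L$ over $\mathbb R^p$. Then $\theta=(F^{\mathsf T}F)^{-1}F^{\mathsf T}\boldsymbol\mu$ is a minimiser of $L$. If moreover $n-q>2$, then $L(t)<\infty$ for every $t\in\mathbb R^p$ and $\theta$ is the only minimiser of $L$. -/

import Mathlib

open MeasureTheory ProbabilityTheory Matrix
open scoped ENNReal

noncomputable section

namespace GibbsDesign

/-- The space `[-1,1]^k` of values of the controllable variables. -/
abbrev Treatment (k : ℕ) : Type := Set.Icc (-1 : Fin k → ℝ) 1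

/-- The rows `xbar 1, …, xbar q` list, without repetition, the distinct values among the
rows `x 1, …, x n` of the design. -/
structure IsUniqueTreatments {k n q : ℕ} (x : Fin n → Treatment k) (xbar : Fin q → Treatment k) :
    Prop where
  injective : Function.Injective xbar
  range_eq : Set.range xbar = Set.range x

/-- The `n × p` model matrix `F`, whose `i`th row is `f (x i)`. -/
def modelMatrix {k n p : ℕ} (f : Treatment k → Fin p → ℝ) (x : Fin n → Treatment k) :
    Matrix (Fin n) (Fin p) ℝ :=
  Matrix.of fun i j => f (x i) j

open Classical in
/-- The `n × q` model matrix `Z` of the unique-treatment model. -/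
def treatmentMatrix {k n q : ℕ} (x : Fin n → Treatment k) (xbar : Fin q → Treatment k) :
    Matrix (Fin n) (Fin q) ℝ :=
  Matrix.of fun i j => if x i = xbar j then 1 else 0

/-- The hat matrix `H_A = A (Aᵀ A)⁻¹ Aᵀ`. -/
def hatMatrix {n m : ℕ} (A : Matrix (Fin n) (Fin m) ℝ) : Matrix (Fin n) (Fin n) ℝ :=
  A * (Aᵀ * A)⁻¹ * Aᵀ

/-- The estimate `yᵀ (I - H_Z) y / (n - q)` of the error variance under the
unique-treatment model. -/
def pureErrorVariance {k n q : ℕ} (x : Fin n → Treatment k) (xbar : Fin q → Treatment k)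
    (y : EuclideanSpace ℝ (Fin n)) : ℝ :=
  (1 / ((n : ℝ) - (q : ℝ))) *
    (y.ofLp ⬝ᵥ ((1 - hatMatrix (treatmentMatrix x xbar)) *ᵥ y.ofLp))

/-- The calibration weight `w = 1 / (2 σ̃²)`. -/
def calibrationWeight {k n q : ℕ} (x : Fin n → Treatment k) (xbar : Fin q → Treatment k)
    (y : EuclideanSpace ℝ (Fin n)) : ℝ :=
  1 / (2 * pureErrorVariance x xbar y)

/-- The sum of squares loss `∑ i, (y i - f(x i)ᵀ t)²`. -/
def ssLoss {k n p : ℕ} (f : Treatment k → Fin p → ℝ) (x : Fin n → Treatment k)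
    (t : Fin p → ℝ) (y : EuclideanSpace ℝ (Fin n)) : ℝ :=
  ∑ i, (y i - f (x i) ⬝ᵥ t) ^ 2

/-- The designer distribution `N(Z μbar, κ I)`, where `μbar j = μ (xbar j)`. -/
def designerDistribution {k n q : ℕ} (x : Fin n → Treatment k) (xbar : Fin q → Treatment k)
    (μ : Treatment k → ℝ) (κ : ℝ) : Measure (EuclideanSpace ℝ (Fin n)) :=
  multivariateGaussian
    (WithLp.toLp 2 (treatmentMatrix x xbar *ᵥ fun j => μ (xbar j)))
    (κ • (1 : Matrix (Fin n) (Fin n) ℝ))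

/-- The expected loss `E_D [w(y) ℓ(t; y)]`, in `[0,∞]`, of a nonnegative weighted loss. -/
def expectedLoss {Y T : Type*} [MeasurableSpace Y] (D : Measure Y) (w : Y → ℝ)
    (loss : T → Y → ℝ) (t : T) : ℝ≥0∞ :=
  ∫⁻ y, ENNReal.ofReal (w y * loss t y) ∂D

/-- The set `arg min_t E_D [w(y) ℓ(t; y)]` of target parameter values. -/
def targetValues {Y T : Type*} [MeasurableSpace Y] (D : Measure Y) (w : Y → ℝ)
    (loss : T → Y → ℝ) : Set T :=
  {t | ∀ s, expectedLoss D w loss t ≤ expectedLoss D w loss s}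

/-- The projected mean `(Fᵀ F)⁻¹ Fᵀ m` of a mean vector `m`. -/
def projectedMean {n p : ℕ} (F : Matrix (Fin n) (Fin p) ℝ) (m : Fin n → ℝ) : Fin p → ℝ :=
  ((Fᵀ * F)⁻¹ * Fᵀ) *ᵥ m

/-- The quadratic form of `I - H_A` is nonnegative. -/
lemma quadForm_one_sub_hatMatrix_nonneg {n m : ℕ} (A : Matrix (Fin n) (Fin m) ℝ)
    (v : Fin n → ℝ) : 0 ≤ v ⬝ᵥ ((1 - hatMatrix A) *ᵥ v) := by
  have hsymm : (1 - hatMatrix A)ᵀ = 1 - hatMatrix A := by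
    simp [hatMatrix, Matrix.transpose_mul, Matrix.transpose_nonsing_inv, Matrix.mul_assoc]
  have hidem : hatMatrix A * hatMatrix A = hatMatrix A := by
    by_cases h : IsUnit (Aᵀ * A).det
    · have h1 : (Aᵀ * A)⁻¹ * (Aᵀ * A) = 1 := Matrix.nonsing_inv_mul _ h
      calc hatMatrix A * hatMatrix A
          = A * ((Aᵀ * A)⁻¹ * (Aᵀ * A)) * (Aᵀ * A)⁻¹ * Aᵀ := by
            simp only [hatMatrix, Matrix.mul_assoc]
        _ = hatMatrix A := by rw [h1, Matrix.mul_one, hatMatrix]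
    · simp [hatMatrix, Matrix.nonsing_inv_apply_not_isUnit _ h]
  have hM : 1 - hatMatrix A = (1 - hatMatrix A)ᵀ * (1 - hatMatrix A) := by
    rw [hsymm]
    simp [Matrix.sub_mul, Matrix.mul_sub, hidem]
  rw [hM, ← Matrix.mulVec_mulVec, Matrix.dotProduct_mulVec, Matrix.vecMul_transpose]
  exact Finset.sum_nonneg fun i _ => mul_self_nonneg _

/-- The weighted sum of squares loss is nonnegative, so that `expectedLoss` is its expectation. -/
lemma weighted_ssLoss_nonneg {k n p q : ℕ} (f : Treatment k → Fin p → ℝ)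
    (x : Fin n → Treatment k) (xbar : Fin q → Treatment k) (hq : q < n)
    (t : Fin p → ℝ) (y : EuclideanSpace ℝ (Fin n)) :
    0 ≤ calibrationWeight x xbar y * ssLoss f x t y := by
  have h1 : (0 : ℝ) ≤ (n : ℝ) - (q : ℝ) := by
    have : (q : ℝ) < n := by exact_mod_cast hq
    linarith
  have h2 := quadForm_one_sub_hatMatrix_nonneg (treatmentMatrix x xbar) y.ofLp
  have h3 : 0 ≤ pureErrorVariance x xbar y := mul_nonneg (one_div_nonneg.2 h1) h2
  exact mul_nonneg (one_div_nonneg.2 (by linarith)) (Finset.sum_nonneg fun i _ => sq_nonneg _)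

end GibbsDesign

end

/-! Write `y = m + √κ z` with `z` standard Gaussian and `m` the mean vector, and let `K` be the
column space of `Z`. Since `m ∈ K`, the weight is a constant times `‖P z‖⁻²`, with `P` the
projection on `Kᗮ`. Since `f (x i)` depends on the treatment only, `m - F t` also lies in `K`. The
reflection that fixes `Kᗮ` and negates `K` preserves the law of `z` and the weight, but flips the
cross term of `‖m - F t + √κ z‖²`. Hence `L(t)` is a constant times `E[‖P z‖⁻² (‖m - F t‖² + κ
‖z‖²)]` (`expectedLoss_eq_lintegral`). This is monotone in `‖m - F t‖`, which least squares
minimises at `θ`, whether or not the expectation is finite.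

Strictness needs `L(θ) < ∞`, which follows from an inverse chi-square moment
(`integrable_stdGaussian_inv_norm_starProjection_sq`), as `dim Kᗮ ≥ n - q > 2`. With `d > 2`
orthonormal coordinates `v i` in `Kᗮ`, the AM-GM inequality bounds `‖P z‖⁻²` by the product of the
`|v i| ^ (-2/d)`, and `1 + ‖z‖²` is at most the product of all `1 + v i ^ 2`. By independence the
expectation of the bound factors into one-dimensional moments, finite because `-2/d > -1`. -/

namespace GibbsDesign

/-! ### One-dimensional Gaussian moments -/

/-- A standard Gaussian variable has absolute moments of every order above `-1`. -/
lemma integrable_abs_rpow_gaussianReal {r : ℝ} (hr : -1 < r) :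
    Integrable (fun s : ℝ => |s| ^ r) (gaussianReal 0 1) := by
  have hIoi : IntegrableOn (fun s : ℝ => |s| ^ r * Real.exp (-(1 / 2) * s ^ 2)) (Set.Ioi 0) :=
    (integrableOn_rpow_mul_exp_neg_mul_sq one_half_pos hr).congr_fun
      (fun s hs => by simp only [abs_of_pos (Set.mem_Ioi.1 hs)]) measurableSet_Ioi
  have hvol : Integrable (fun s : ℝ => |s| ^ r * Real.exp (-(1 / 2) * s ^ 2)) := by
    rw [← integrableOn_univ, ← @Set.Iio_union_Ici _ _ (0 : ℝ), integrableOn_union,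
      integrableOn_Ici_iff_integrableOn_Ioi]
    refine ⟨?_, hIoi⟩
    rw [← (Measure.measurePreserving_neg (volume : Measure ℝ)).integrableOn_comp_preimage
      (Homeomorph.neg ℝ).measurableEmbedding]
    simpa [Function.comp_def] using hIoi
  rw [gaussianReal_of_var_ne_zero _ one_ne_zero,
    integrable_withDensity_iff (measurable_gaussianPDF _ _)
      (Filter.Eventually.of_forall fun _ => ENNReal.ofReal_lt_top)]
  refine (hvol.const_mul (√(2 * Real.pi))⁻¹).congr (Filter.Eventually.of_forall fun s => ?_)
  simp only [toReal_gaussianPDF, gaussianPDFReal]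
  simp
  ring_nf

/-- A standard Gaussian variable has second moment weighted by a negative power above `-1`. -/
lemma integrable_one_add_sq_mul_abs_rpow_gaussianReal {r : ℝ} (hr : -1 < r) :
    Integrable (fun s : ℝ => (1 + s ^ 2) * |s| ^ r) (gaussianReal 0 1) := by
  have h2 : Integrable (fun s : ℝ => |s| ^ (r + 2)) (gaussianReal 0 1) :=
    integrable_abs_rpow_gaussianReal (by linarith)
  refine ((integrable_abs_rpow_gaussianReal hr).add h2).mono'
    (Measurable.aestronglyMeasurable (by fun_prop)) (Filter.Eventually.of_forall fun s => ?_)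
  have h0 : 0 ≤ |s| ^ r := Real.rpow_nonneg (abs_nonneg s) r
  rw [Real.norm_of_nonneg (by positivity)]
  simp only [Pi.add_apply]
  -- `Real.rpow_add` needs a positive base; at zero the extra summand only has to be nonnegative.
  rcases eq_or_ne s 0 with rfl | hs
  · simp only [abs_zero]
    have := Real.rpow_nonneg le_rfl (r + 2)
    nlinarith
  · rw [Real.rpow_add (abs_pos.2 hs), Real.rpow_two, sq_abs]
    exact le_of_eq (by ring)

/-! ### Orthonormal coordinates and sums of squares -/

section Projection

variable {E : Type*} [NormedAddCommGroup E] [InnerProductSpace ℝ E] [FiniteDimensional ℝ E]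

/-- Some orthonormal basis of `E` has `finrank ℝ U` members in the subspace `U`. -/
lemma exists_orthonormalBasis_mem_subspace (U : Submodule ℝ E) :
    ∃ (u : Finset E) (b : OrthonormalBasis u ℝ E) (S : Finset u),
      Module.finrank ℝ U ≤ S.card ∧ ∀ i ∈ S, b i ∈ U := by
  classical
  have hv : Orthonormal ℝ (fun i => (stdOrthonormalBasis ℝ U i : E)) :=
    (stdOrthonormalBasis ℝ U).orthonormal.comp_linearIsometry U.subtypeₗᵢ
  obtain ⟨u, b, hu, hb⟩ := hv.toSubtypeRange.exists_orthonormalBasis_extension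
  refine ⟨u, b, Finset.univ.filter fun i => b i ∈ U, ?_, by simp⟩
  let g : Fin (Module.finrank ℝ U) → u := fun i => ⟨_, hu (Set.mem_range_self i)⟩
  have hg : Function.Injective g := fun i j hij =>
    hv.linearIndependent.injective (by simpa [g] using hij)
  calc Module.finrank ℝ U = (Finset.univ.image g).card := by
        rw [Finset.card_image_of_injective _ hg, Finset.card_univ, Fintype.card_fin]
    _ ≤ _ := by
        refine Finset.card_le_card fun i hi => ?_
        obtain ⟨j, -, rfl⟩ := Finset.mem_image.1 hi
        simp [hb, g]

/-- Bessel's inequality for basis vectors in a subspace. -/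
lemma sum_sq_le_norm_starProjection_sq {ι : Type*} [Fintype ι] (b : OrthonormalBasis ι ℝ E)
    (U : Submodule ℝ E) {S : Finset ι} (hS : ∀ i ∈ S, b i ∈ U) (v : ι → ℝ) :
    ∑ i ∈ S, v i ^ 2 ≤ ‖U.starProjection (∑ i, v i • b i)‖ ^ 2 := by
  rw [← b.sum_sq_inner_right]
  refine le_trans (le_of_eq (Finset.sum_congr rfl fun i hi => ?_))
    (Finset.sum_le_univ_sum_of_nonneg fun i => sq_nonneg _)
  -- The projection is self-adjoint and fixes `b i`, so the `i`th coordinate survives projection.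
  rw [← Submodule.inner_starProjection_left_eq_right,
    Submodule.starProjection_eq_self_iff.2 (hS i hi), b.orthonormal.inner_right_fintype]

/-- Expanding the product yields the left side plus nonnegative terms. The product form lets the
expectation factor over independent coordinates. -/
lemma one_add_sum_sq_le_prod {ι : Type*} (s : Finset ι) (v : ι → ℝ) :
    1 + ∑ i ∈ s, v i ^ 2 ≤ ∏ i ∈ s, (1 + v i ^ 2) := by
  classical
  induction s using Finset.induction_on with
  | empty => simp
  | insert a s ha ih =>
    rw [Finset.sum_insert ha, Finset.prod_insert ha]
    have : 0 ≤ ∑ i ∈ s, v i ^ 2 := Finset.sum_nonneg fun i _ => sq_nonneg _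
    nlinarith [sq_nonneg (v a)]

/-- The inequality of arithmetic and geometric means, for the reciprocal of a sum of squares. -/
lemma inv_sum_sq_le_prod_rpow {ι : Type*} (S : Finset ι) (hS : S.Nonempty) (v : ι → ℝ)
    (hv : ∀ i ∈ S, v i ≠ 0) :
    (∑ i ∈ S, v i ^ 2)⁻¹ ≤ ∏ i ∈ S, |v i| ^ (-(2 / (S.card : ℝ))) := by
  have hc : (1 : ℝ) ≤ S.card := by exact_mod_cast hS.card_pos
  have hc0 : (0 : ℝ) < S.card := by linarith
  have hamgm := Real.geom_mean_le_arith_mean_weighted S (fun _ => (S.card : ℝ)⁻¹)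
    (fun i => v i ^ 2) (fun _ _ => by positivity) (by simp [hc0.ne'])
    (fun i _ => sq_nonneg _)
  have hprod : ∏ i ∈ S, |v i| ^ (-(2 / (S.card : ℝ)))
      = (∏ i ∈ S, (v i ^ 2) ^ (S.card : ℝ)⁻¹)⁻¹ := by
    rw [← Finset.prod_inv_distrib]
    refine Finset.prod_congr rfl fun i _ => ?_
    rw [Real.rpow_neg (abs_nonneg _), ← sq_abs, ← Real.rpow_two, ← Real.rpow_mul (abs_nonneg _),
      div_eq_mul_inv]
  rw [hprod]
  have hpos : 0 < ∏ i ∈ S, (v i ^ 2) ^ (S.card : ℝ)⁻¹ :=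
    Finset.prod_pos fun i hi => Real.rpow_pos_of_pos (sq_pos_of_ne_zero (hv i hi)) _
  -- The factor `1 / S.card` of the arithmetic mean is simply discarded.
  refine inv_anti₀ hpos (hamgm.trans ?_)
  rw [← Finset.mul_sum]
  exact mul_le_of_le_one_left (Finset.sum_nonneg fun i _ => sq_nonneg _) (inv_le_one_of_one_le₀ hc)

/-! ### Projections and reflections of a standard Gaussian vector -/

variable [MeasurableSpace E] [BorelSpace E]

lemma ae_pi_gaussianReal_ne_zero (ι : Type*) [Fintype ι] :
    ∀ᵐ v ∂(Measure.pi fun _ : ι => gaussianReal 0 1), ∀ i, v i ≠ 0 := by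
  have := nullSingletonClass_gaussianReal (μ := 0) one_ne_zero
  refine ae_all_iff.2 fun i => ?_
  exact (measurePreserving_eval (fun _ : ι => gaussianReal 0 1) i).quasiMeasurePreserving.ae
    (Measure.ae_ne _ (0 : ℝ))

/-- A standard Gaussian vector almost surely has nonzero projection on a nonzero subspace. -/
lemma ae_stdGaussian_starProjection_ne_zero (U : Submodule ℝ E) (hU : 0 < Module.finrank ℝ U) :
    ∀ᵐ z ∂stdGaussian E, U.starProjection z ≠ 0 := by
  obtain ⟨u, b, S, hS, hbS⟩ := exists_orthonormalBasis_mem_subspace U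
  have hmeas : MeasurableSet {z : E | U.starProjection z ≠ 0} :=
    (measurableSet_eq_fun (by fun_prop) measurable_const).compl
  rw [stdGaussian_eq_map_pi_orthonormalBasis b, ae_map_iff (Measurable.aemeasurable (by fun_prop))
    hmeas]
  filter_upwards [ae_pi_gaussianReal_ne_zero u] with v hv h0
  obtain ⟨i, hi⟩ := Finset.card_pos.1 (hU.trans_le hS)
  have := sum_sq_le_norm_starProjection_sq b U hbS v
  rw [h0, norm_zero] at this
  have := Finset.single_le_sum (fun j _ => sq_nonneg (v j)) hi
  have := sq_pos_of_ne_zero (hv i)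
  linarith

/-- The inverse chi-square moment: for a standard Gaussian vector `z` and a subspace `U` of
dimension at least three, `(1 + ‖z‖²) / ‖P_U z‖²` is integrable. -/
lemma integrable_stdGaussian_inv_norm_starProjection_sq (U : Submodule ℝ E)
    (hU : 2 < Module.finrank ℝ U) :
    Integrable (fun z => (‖U.starProjection z‖ ^ 2)⁻¹ * (1 + ‖z‖ ^ 2)) (stdGaussian E) := by
  classical
  obtain ⟨u, b, S, hS, hbS⟩ := exists_orthonormalBasis_mem_subspace U
  have hcard : (2 : ℝ) < S.card := by exact_mod_cast hU.trans_le hS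
  have hSne : S.Nonempty := Finset.card_pos.1 (by omega)
  have hmeas : Measurable fun z : E => (‖U.starProjection z‖ ^ 2)⁻¹ * (1 + ‖z‖ ^ 2) := by fun_prop
  rw [stdGaussian_eq_map_pi_orthonormalBasis b,
    integrable_map_measure hmeas.aestronglyMeasurable (Measurable.aemeasurable (by fun_prop))]
  -- Exponent zero off `S` gives the factor one. On `S`, the exponent exceeds `-1` exactly because
  -- `S.card > 2`.
  let r : u → ℝ := fun i => if i ∈ S then -(2 / (S.card : ℝ)) else 0
  have hr : ∀ i, -1 < r i := by
    intro i
    simp only [r]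
    split_ifs
    · rw [neg_lt_neg_iff, div_lt_one (by linarith)]
      exact hcard
    · norm_num
  refine (Integrable.fintype_prod (fun i =>
    integrable_one_add_sq_mul_abs_rpow_gaussianReal (hr i))).mono'
    (hmeas.comp (by fun_prop)).aestronglyMeasurable ?_
  filter_upwards [ae_pi_gaussianReal_ne_zero u] with v hv
  have hsum_pos : 0 < ∑ i ∈ S, v i ^ 2 :=
    Finset.sum_pos (fun i _ => sq_pos_of_ne_zero (hv i)) hSne
  have hnorm : ‖∑ i, v i • b i‖ ^ 2 = ∑ i, v i ^ 2 := by
    rw [← b.sum_sq_inner_right]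
    exact Finset.sum_congr rfl fun i _ => by rw [b.orthonormal.inner_right_fintype]
  have hprod : ∏ i ∈ S, |v i| ^ (-(2 / (S.card : ℝ))) = ∏ i, |v i| ^ r i := by
    rw [← Finset.prod_subset (Finset.subset_univ S)]
    · exact Finset.prod_congr rfl fun i hi => by simp [r, hi]
    · intro i _ hi
      simp [r, hi]
  rw [Function.comp_apply, Real.norm_of_nonneg (by positivity), Finset.prod_mul_distrib, mul_comm,
    ← hprod, hnorm]
  refine mul_le_mul (one_add_sum_sq_le_prod _ v) ?_ (by positivity)
    (Finset.prod_nonneg fun i _ => by positivity)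
  exact (inv_anti₀ hsum_pos (sum_sq_le_norm_starProjection_sq b U hbS v)).trans
    (inv_sum_sq_le_prod_rpow S hSne v fun i _ => hv i)

/-- The cross term vanishes in the expectation of a weighted squared distance, when the weight
is invariant under the reflection that reverses the direction of the shift. -/
lemma lintegral_stdGaussian_weighted_norm_add_smul_sq (K : Submodule ℝ E) {g : E → ℝ}
    (hg : Measurable g) (hg0 : ∀ z, 0 ≤ g z) (hgr : ∀ z, g (Kᗮ.reflection z) = g z)
    {a : E} (ha : a ∈ K) (s : ℝ) :
    ∫⁻ z, ENNReal.ofReal (g z * ‖a + s • z‖ ^ 2) ∂stdGaussian E =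
      ∫⁻ z, ENNReal.ofReal (g z * (‖a‖ ^ 2 + s ^ 2 * ‖z‖ ^ 2)) ∂stdGaussian E := by
  have hm : Measurable fun z => ENNReal.ofReal (g z * ‖a + s • z‖ ^ 2) := by fun_prop
  have hrefl : ∫⁻ z, ENNReal.ofReal (g z * ‖a + s • z‖ ^ 2) ∂stdGaussian E =
      ∫⁻ z, ENNReal.ofReal (g z * ‖a + s • Kᗮ.reflection z‖ ^ 2) ∂stdGaussian E := by
    conv_lhs => rw [← stdGaussian_map (Kᗮ.reflection)]
    rw [lintegral_map hm (by fun_prop)]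
    simp only [hgr]
  -- Adding the integrand to its reflection cancels the cross term pointwise, so no integrability is
  -- needed.
  have hpt : ∀ z, ENNReal.ofReal (g z * ‖a + s • z‖ ^ 2) +
      ENNReal.ofReal (g z * ‖a + s • Kᗮ.reflection z‖ ^ 2) =
        2 * ENNReal.ofReal (g z * (‖a‖ ^ 2 + s ^ 2 * ‖z‖ ^ 2)) := by
    intro z
    have hinner : inner ℝ a (Kᗮ.reflection z) = -inner ℝ a z := by
      rw [← (Kᗮ.reflection).inner_map_map, Submodule.reflection_reflection,
        Submodule.reflection_mem_subspace_orthogonal_precomplement_eq_neg ha, inner_neg_left]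
    rw [← ENNReal.ofReal_add (mul_nonneg (hg0 z) (sq_nonneg _)) (mul_nonneg (hg0 z) (sq_nonneg _)),
      ← ENNReal.ofReal_ofNat 2, ← ENNReal.ofReal_mul (by norm_num)]
    congr 1
    rw [norm_add_sq_real, norm_add_sq_real, inner_smul_right, inner_smul_right, hinner, norm_smul,
      norm_smul, LinearIsometryEquiv.norm_map, mul_pow, Real.norm_eq_abs, sq_abs]
    ring
  refine (ENNReal.mul_right_inj two_ne_zero ENNReal.ofNat_ne_top).1 ?_
  rw [two_mul]
  nth_rw 2 [hrefl]
  rw [← lintegral_add_left hm, ← lintegral_const_mul _ (by fun_prop)]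
  exact lintegral_congr hpt

end Projection

/-! ### Column spaces, hat matrices and the designer distribution -/

/-- The column space of a matrix, as a subspace of Euclidean space. -/
noncomputable def columnSpace {n m : ℕ} (A : Matrix (Fin n) (Fin m) ℝ) :
    Submodule ℝ (EuclideanSpace ℝ (Fin n)) :=
  LinearMap.range (Matrix.toEuclideanLin A)

lemma toLp_mulVec_mem_columnSpace {n m : ℕ} (A : Matrix (Fin n) (Fin m) ℝ) (v : Fin m → ℝ) :
    WithLp.toLp 2 (A *ᵥ v) ∈ columnSpace A :=
  ⟨WithLp.toLp 2 v, rfl⟩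

/-- The rank is at most the number of columns. The additive form avoids truncated subtraction. -/
lemma finrank_orthogonal_columnSpace {n m : ℕ} (A : Matrix (Fin n) (Fin m) ℝ) :
    n ≤ m + Module.finrank ℝ (columnSpace A)ᗮ := by
  have h1 := (columnSpace A).finrank_add_finrank_orthogonal
  have h2 : Module.finrank ℝ (columnSpace A) ≤ Module.finrank ℝ (EuclideanSpace ℝ (Fin m)) :=
    LinearMap.finrank_range_le _
  simp only [finrank_euclideanSpace, Fintype.card_fin] at h1 h2
  omega

/-- The hat matrix of a matrix of full column rank is the orthogonal projection on the
column space. -/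
lemma starProjection_columnSpace {n m : ℕ} (A : Matrix (Fin n) (Fin m) ℝ)
    (hA : IsUnit (Aᵀ * A).det) (y : EuclideanSpace ℝ (Fin n)) :
    (columnSpace A).starProjection y = WithLp.toLp 2 (hatMatrix A *ᵥ y.ofLp) := by
  refine (Submodule.eq_starProjection_of_mem_of_inner_eq_zero ?_ ?_)
  · rw [hatMatrix, Matrix.mul_assoc, ← Matrix.mulVec_mulVec]
    exact toLp_mulVec_mem_columnSpace _ _
  · rintro - ⟨v, rfl⟩
    have h : Aᵀ *ᵥ (y.ofLp - hatMatrix A *ᵥ y.ofLp) = 0 := by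
      rw [Matrix.mulVec_sub, Matrix.mulVec_mulVec, hatMatrix, ← Matrix.mul_assoc,
        ← Matrix.mul_assoc, Matrix.mul_nonsing_inv _ hA, Matrix.one_mul, sub_self]
    rw [EuclideanSpace.inner_eq_star_dotProduct]
    change (A *ᵥ v.ofLp) ⬝ᵥ (y.ofLp - hatMatrix A *ᵥ y.ofLp) = 0
    rw [dotProduct_comm, Matrix.dotProduct_mulVec, ← Matrix.mulVec_transpose, h, zero_dotProduct]

lemma quadForm_one_sub_hatMatrix {n m : ℕ} (A : Matrix (Fin n) (Fin m) ℝ)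
    (hA : IsUnit (Aᵀ * A).det) (y : EuclideanSpace ℝ (Fin n)) :
    y.ofLp ⬝ᵥ ((1 - hatMatrix A) *ᵥ y.ofLp) = ‖(columnSpace A)ᗮ.starProjection y‖ ^ 2 := by
  have h : (columnSpace A)ᗮ.starProjection y = WithLp.toLp 2 ((1 - hatMatrix A) *ᵥ y.ofLp) := by
    rw [Submodule.starProjection_orthogonal_val, starProjection_columnSpace A hA, Matrix.sub_mulVec,
      Matrix.one_mulVec]
    rfl
  have h2 : inner ℝ ((columnSpace A)ᗮ.starProjection y) y =
      ‖(columnSpace A)ᗮ.starProjection y‖ ^ 2 := by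
    rw [← real_inner_self_eq_norm_sq, Submodule.inner_starProjection_left_eq_right,
      Submodule.inner_starProjection_left_eq_right,
      Submodule.starProjection_eq_self_iff.2 (Submodule.starProjection_apply_mem _ _)]
  rw [← h2, h, EuclideanSpace.inner_eq_star_dotProduct]
  simp

/-- Each row of `Z` has exactly one nonzero entry. Thus every function of the treatment, read along
the design, lies in the column space of `Z`. -/
lemma treatmentMatrix_mulVec {k n q : ℕ} {x : Fin n → Treatment k} {xbar : Fin q → Treatment k}
    (hxbar : IsUniqueTreatments x xbar) (g : Treatment k → ℝ) :
    (treatmentMatrix x xbar *ᵥ fun j => g (xbar j)) = fun i => g (x i) := by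
  classical
  funext i
  obtain ⟨j, hj⟩ : x i ∈ Set.range xbar := hxbar.range_eq ▸ Set.mem_range_self i
  simp only [treatmentMatrix, Matrix.mulVec, dotProduct, Matrix.of_apply, ite_mul, one_mul,
    zero_mul]
  rw [Finset.sum_eq_single j]
  · simp [hj]
  · intro l _ hl
    rw [if_neg]
    rw [← hj]
    exact fun h => hl (hxbar.injective h).symm
  · simp

/-- Every distinct treatment occurs in some run, so a vector killed by `Z` has all entries zero. -/
lemma isUnit_det_treatmentMatrix {k n q : ℕ} {x : Fin n → Treatment k}
    {xbar : Fin q → Treatment k} (hxbar : IsUniqueTreatments x xbar) :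
    IsUnit ((treatmentMatrix x xbar)ᵀ * treatmentMatrix x xbar).det := by
  rw [← Matrix.isUnit_iff_isUnit_det, ← Matrix.mulVec_injective_iff_isUnit]
  have hker := Matrix.ker_mulVecLin_transpose_mul_self (treatmentMatrix x xbar)
  change Function.Injective (Matrix.mulVecLin _)
  rw [← LinearMap.ker_eq_bot, hker]
  rw [Submodule.eq_bot_iff]
  intro v hv
  have hv' : treatmentMatrix x xbar *ᵥ v = 0 := hv
  -- Extending `v` to a function on all treatments makes `treatmentMatrix_mulVec` applicable.
  have hext : v = fun j => Function.extend xbar v 0 (xbar j) :=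
    funext fun j => (hxbar.injective.extend_apply v 0 j).symm
  rw [hext, treatmentMatrix_mulVec hxbar] at hv'
  funext j
  obtain ⟨i, hi⟩ : xbar j ∈ Set.range x := hxbar.range_eq ▸ Set.mem_range_self j
  have := congrFun hv' i
  simpa only [hi, hxbar.injective.extend_apply, Pi.zero_apply] using this

open scoped MatrixOrder in
lemma multivariateGaussian_smul_one {n : ℕ} (m : EuclideanSpace ℝ (Fin n)) {κ : ℝ} (hκ : 0 ≤ κ) :
    multivariateGaussian m (κ • (1 : Matrix (Fin n) (Fin n) ℝ)) =
      (stdGaussian (EuclideanSpace ℝ (Fin n))).map fun z => m + √κ • z := by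
  have hsqrt : CFC.sqrt (κ • (1 : Matrix (Fin n) (Fin n) ℝ)) = √κ • 1 := by
    refine CFC.sqrt_unique ?_ ?_
    · rw [smul_mul_smul_comm, Real.mul_self_sqrt hκ, mul_one]
    · exact smul_nonneg (Real.sqrt_nonneg κ) zero_le_one
  rw [multivariateGaussian, hsqrt]
  simp

/-! ### Least squares and the reduced form of the expected loss -/

/-- The sum of squares loss is a squared Euclidean distance. -/
lemma ssLoss_eq_norm_sq {k n p : ℕ} (f : Treatment k → Fin p → ℝ) (x : Fin n → Treatment k)
    (t : Fin p → ℝ) (y : EuclideanSpace ℝ (Fin n)) :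
    ssLoss f x t y = ‖y - WithLp.toLp 2 (modelMatrix f x *ᵥ t)‖ ^ 2 := by
  rw [EuclideanSpace.real_norm_sq_eq]
  rfl

/-- Fitted values agree on replicated treatments. This places the shift `m - F t` in the subspace
negated by the reflection. -/
lemma modelMatrix_mulVec_mem_columnSpace {k n p q : ℕ} {x : Fin n → Treatment k}
    {xbar : Fin q → Treatment k} (hxbar : IsUniqueTreatments x xbar)
    (f : Treatment k → Fin p → ℝ) (t : Fin p → ℝ) :
    WithLp.toLp 2 (modelMatrix f x *ᵥ t) ∈ columnSpace (treatmentMatrix x xbar) := by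
  have : modelMatrix f x *ᵥ t = treatmentMatrix x xbar *ᵥ fun j => f (xbar j) ⬝ᵥ t :=
    (treatmentMatrix_mulVec hxbar fun w => f w ⬝ᵥ t).symm
  rw [this]
  exact toLp_mulVec_mem_columnSpace _ _

/-- The Pythagorean identity for least squares. -/
lemma norm_sub_mulVec_sq {n p : ℕ} (F : Matrix (Fin n) (Fin p) ℝ) (hF : IsUnit (Fᵀ * F).det)
    (m : Fin n → ℝ) (t : Fin p → ℝ) :
    ‖WithLp.toLp 2 (m - F *ᵥ t)‖ ^ 2 =
      ‖WithLp.toLp 2 (m - F *ᵥ projectedMean F m)‖ ^ 2 +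
        ‖WithLp.toLp 2 (F *ᵥ (projectedMean F m - t))‖ ^ 2 := by
  have hortho : Fᵀ *ᵥ (m - F *ᵥ projectedMean F m) = 0 := by
    rw [projectedMean, Matrix.mulVec_sub, Matrix.mulVec_mulVec, Matrix.mulVec_mulVec,
      ← Matrix.mul_assoc, Matrix.mul_nonsing_inv _ hF, Matrix.one_mul, sub_self]
  have hinner : inner ℝ (WithLp.toLp 2 (m - F *ᵥ projectedMean F m))
      (WithLp.toLp 2 (F *ᵥ (projectedMean F m - t))) = 0 := by
    rw [real_inner_comm, EuclideanSpace.inner_eq_star_dotProduct]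
    change (m - F *ᵥ projectedMean F m) ⬝ᵥ (F *ᵥ (projectedMean F m - t)) = 0
    rw [Matrix.dotProduct_mulVec, ← Matrix.mulVec_transpose, hortho, zero_dotProduct]
  have hsplit : WithLp.toLp 2 (m - F *ᵥ t) = WithLp.toLp 2 (m - F *ᵥ projectedMean F m) +
      WithLp.toLp 2 (F *ᵥ (projectedMean F m - t)) := by
    rw [← WithLp.toLp_add, Matrix.mulVec_sub, sub_add_sub_cancel]
  rw [hsplit, norm_add_sq_real, hinner]
  ring

lemma mulVec_injective_of_isUnit_det {n p : ℕ} (F : Matrix (Fin n) (Fin p) ℝ)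
    (hF : IsUnit (Fᵀ * F).det) : Function.Injective F.mulVec := by
  intro s t hst
  have : (Fᵀ * F) *ᵥ s = (Fᵀ * F) *ᵥ t := by
    rw [← Matrix.mulVec_mulVec, ← Matrix.mulVec_mulVec]
    exact congrArg _ hst
  exact Matrix.mulVec_injective_iff_isUnit.2 ((Matrix.isUnit_iff_isUnit_det _).2 hF) this

/-- The expected weighted loss depends on the parameter only through the distance of the mean
vector from the fitted vector. -/
lemma expectedLoss_eq_lintegral {k n p q : ℕ} {x : Fin n → Treatment k}
    {xbar : Fin q → Treatment k} (hxbar : IsUniqueTreatments x xbar) (hq : q < n)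
    (f : Treatment k → Fin p → ℝ) (μ : Treatment k → ℝ) {κ : ℝ} (hκ : 0 < κ) (t : Fin p → ℝ) :
    expectedLoss (designerDistribution x xbar μ κ) (calibrationWeight x xbar) (ssLoss f x) t =
      ∫⁻ z, ENNReal.ofReal (((n : ℝ) - q) / (2 * κ) *
        (‖(columnSpace (treatmentMatrix x xbar))ᗮ.starProjection z‖ ^ 2)⁻¹ *
          (‖WithLp.toLp 2 ((fun i => μ (x i)) - modelMatrix f x *ᵥ t)‖ ^ 2 + κ * ‖z‖ ^ 2))
        ∂stdGaussian (EuclideanSpace ℝ (Fin n)) := by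
  set K := columnSpace (treatmentMatrix x xbar) with hK
  set m : EuclideanSpace ℝ (Fin n) := WithLp.toLp 2 fun i => μ (x i) with hm
  have hnq : (0 : ℝ) < (n : ℝ) - q := sub_pos.2 (by exact_mod_cast hq)
  have hmK : m ∈ K := by
    rw [hm, ← treatmentMatrix_mulVec hxbar μ]
    exact toLp_mulVec_mem_columnSpace _ _
  -- This also holds where the projection vanishes: both sides are then zero by the convention for
  -- division.
  have hweight : ∀ y, calibrationWeight x xbar y =
      ((n : ℝ) - q) / 2 * (‖Kᗮ.starProjection y‖ ^ 2)⁻¹ := by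
    intro y
    rw [calibrationWeight, pureErrorVariance,
      quadForm_one_sub_hatMatrix _ (isUnit_det_treatmentMatrix hxbar), ← hK]
    field_simp
  have hweight_shift : ∀ z, calibrationWeight x xbar (m + √κ • z) =
      ((n : ℝ) - q) / (2 * κ) * (‖Kᗮ.starProjection z‖ ^ 2)⁻¹ := by
    intro z
    rw [hweight, map_add, map_smul, (Submodule.starProjection_orthogonal_apply_eq_zero hmK),
      zero_add, norm_smul, mul_pow, Real.norm_eq_abs, sq_abs, Real.sq_sqrt hκ.le, mul_inv]
    field_simp
  have hmeas : Measurable fun y =>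
      ENNReal.ofReal (calibrationWeight x xbar y * ssLoss f x t y) := by
    simp only [hweight, ssLoss_eq_norm_sq]
    fun_prop
  rw [expectedLoss, designerDistribution, treatmentMatrix_mulVec hxbar, ← hm,
    multivariateGaussian_smul_one m hκ.le, lintegral_map hmeas (by fun_prop)]
  have hshift : ∀ z, m + √κ • z - WithLp.toLp 2 (modelMatrix f x *ᵥ t) =
      WithLp.toLp 2 ((fun i => μ (x i)) - modelMatrix f x *ᵥ t) + √κ • z := by
    intro z
    rw [WithLp.toLp_sub, ← hm]
    abel
  simp only [hweight_shift, ssLoss_eq_norm_sq, hshift]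
  have hdiff : WithLp.toLp 2 ((fun i => μ (x i)) - modelMatrix f x *ᵥ t) ∈ K :=
    K.sub_mem hmK (modelMatrix_mulVec_mem_columnSpace hxbar f t)
  rw [lintegral_stdGaussian_weighted_norm_add_smul_sq K (by fun_prop) (fun z => by positivity)
    (fun z => ?_) hdiff]
  · simp only [Real.sq_sqrt hκ.le]
  -- The reflection is `2 P - 1`, and `P (2 P - 1) = P`.
  · rw [show Kᗮ.starProjection (Kᗮ.reflection z) = Kᗮ.starProjection z from ?_]
    rw [Submodule.reflection_apply, map_sub, two_smul, map_add,
      Submodule.starProjection_eq_self_iff.2 (Submodule.starProjection_apply_mem _ _)]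
    abel

end GibbsDesign

/-! ### Minimality, finiteness and uniqueness -/

theorem mainTheorem2 {k n p q : ℕ}
    (x : Fin n → GibbsDesign.Treatment k)
    (xbar : Fin q → GibbsDesign.Treatment k)
    (hxbar : GibbsDesign.IsUniqueTreatments x xbar)
    (hq : q < n)
    (f : GibbsDesign.Treatment k → Fin p → ℝ)
    (hF : IsUnit ((GibbsDesign.modelMatrix f x)ᵀ * GibbsDesign.modelMatrix f x).det)
    (μ : GibbsDesign.Treatment k → ℝ)
    (κ : ℝ) (hκ : 0 < κ) :
    GibbsDesign.projectedMean (GibbsDesign.modelMatrix f x) (fun i => μ (x i)) ∈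
        GibbsDesign.targetValues (GibbsDesign.designerDistribution x xbar μ κ)
          (GibbsDesign.calibrationWeight x xbar) (GibbsDesign.ssLoss f x) ∧
      (q + 2 < n →
        (∀ t : Fin p → ℝ,
          GibbsDesign.expectedLoss (GibbsDesign.designerDistribution x xbar μ κ)
            (GibbsDesign.calibrationWeight x xbar) (GibbsDesign.ssLoss f x) t < ∞) ∧
        GibbsDesign.targetValues (GibbsDesign.designerDistribution x xbar μ κ)
            (GibbsDesign.calibrationWeight x xbar) (GibbsDesign.ssLoss f x) =
          {GibbsDesign.projectedMean (GibbsDesign.modelMatrix f x) (fun i => μ (x i))}) := by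
  set F := GibbsDesign.modelMatrix f x with hFdef
  set θ := GibbsDesign.projectedMean F (fun i => μ (x i)) with hθ
  have hL := GibbsDesign.expectedLoss_eq_lintegral hxbar hq f μ hκ
  have hpyth := GibbsDesign.norm_sub_mulVec_sq F hF (fun i => μ (x i))
  have hnq : (0 : ℝ) < (n : ℝ) - q := sub_pos.2 (by exact_mod_cast hq)
  have hmin : θ ∈ GibbsDesign.targetValues (GibbsDesign.designerDistribution x xbar μ κ)
      (GibbsDesign.calibrationWeight x xbar) (GibbsDesign.ssLoss f x) := by
    intro s
    rw [hL, hL, ← hFdef, hpyth s, ← hθ]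
    refine lintegral_mono fun z => ENNReal.ofReal_le_ofReal ?_
    gcongr
    exact le_add_of_nonneg_right (sq_nonneg _)
  refine ⟨hmin, fun hn => ?_⟩
  have hdim : 2 < Module.finrank ℝ
      (GibbsDesign.columnSpace (GibbsDesign.treatmentMatrix x xbar))ᗮ := by
    have := GibbsDesign.finrank_orthogonal_columnSpace (GibbsDesign.treatmentMatrix x xbar)
    omega
  have hfin : ∀ t : Fin p → ℝ,
      GibbsDesign.expectedLoss (GibbsDesign.designerDistribution x xbar μ κ)
        (GibbsDesign.calibrationWeight x xbar) (GibbsDesign.ssLoss f x) t < ∞ := by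
    intro t
    rw [hL]
    set c := ‖WithLp.toLp 2 ((fun i => μ (x i)) - GibbsDesign.modelMatrix f x *ᵥ t)‖ ^ 2
    have hint := (GibbsDesign.integrable_stdGaussian_inv_norm_starProjection_sq _ hdim).const_mul
      (((n : ℝ) - q) / (2 * κ) * (c + κ))
    refine lt_of_le_of_lt (lintegral_mono fun z => ENNReal.ofReal_le_ofReal ?_)
      hint.lintegral_lt_top
    have hc : 0 ≤ c := sq_nonneg _
    -- This bounds the loss by a constant multiple of the integrable inverse moment.
    have hle : c + κ * ‖z‖ ^ 2 ≤ (c + κ) * (1 + ‖z‖ ^ 2) := by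
      nlinarith [mul_nonneg hc (sq_nonneg ‖z‖)]
    rw [mul_mul_mul_comm]
    gcongr
  refine ⟨hfin, Set.eq_singleton_iff_unique_mem.2 ⟨hmin, fun t ht => ?_⟩⟩
  by_contra hne
  refine (ht θ).not_gt ?_
  have hpos : 0 < ‖WithLp.toLp 2 (F *ᵥ (θ - t))‖ ^ 2 := by
    refine pow_pos (norm_pos_iff.2 fun h => hne ?_) 2
    have h0 : F *ᵥ (θ - t) = F *ᵥ 0 := by
      rw [Matrix.mulVec_zero]
      exact congrArg WithLp.ofLp h
    exact (sub_eq_zero.1 (GibbsDesign.mulVec_injective_of_isUnit_det F hF h0)).symm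
  have hfinθ := (hfin θ).ne
  rw [hL] at hfinθ ⊢
  rw [hL t]
  -- An almost sure strict inequality passes to the integrals only because `L(θ)` is finite; the
  -- weight is almost surely positive.
  refine lintegral_strict_mono (IsProbabilityMeasure.ne_zero _)
    (Measurable.aemeasurable (by fun_prop)) hfinθ ?_
  filter_upwards [GibbsDesign.ae_stdGaussian_starProjection_ne_zero _ (two_pos.trans hdim)] with z hz
  have hw : 0 < ((n : ℝ) - q) / (2 * κ) * (‖(GibbsDesign.columnSpace
      (GibbsDesign.treatmentMatrix x xbar))ᗮ.starProjection z‖ ^ 2)⁻¹ := by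
    have := norm_pos_iff.2 hz
    positivity
  rw [← hFdef, hpyth t, ← hθ]
  refine (ENNReal.ofReal_lt_ofReal_iff_of_nonneg (by positivity)).2 ?_
  gcongr
  exact lt_add_of_pos_right _ hpos
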